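/- **Setting.** Let $\mathcal G=(\mathcal V,\mathcal E)$ be a finite undirected connected graph with neighborhoods $\mathcal N_i$. Consider the problem $$\text{(P)}\quad \min\ \sum_{i\in\mathcal V} f_i(x_i)\quad\text{s.t.}\quad \sum_i A_i^{\rm in}x_i\le b^{\rm in},\quad \sum_i A_i^{\rm eq}x_i=b^{\rm eq},\quad x_i\in\mathcal X_i=\{x\in\mathbb R^{d_i}: g_i^j(x)\le 0,\ j=1,\dots,p_i\},$$ with optimal value $f^\star$. Assume: (a) each $f_i$ is convex and $C^2$ on $\mathcal X_i$, and each $g_i^j:\mathbb R^{d_i}\to\mathbb R$ is convex and $C^2$; (b) there is a point $(\tilde x_i)_i$ satisfying the coupling constraints with $g_i^j(\tilde x_i)<0$ for all $i,j$; (c) the feasible set of (P) is compact; (d) each stacked matrix $A_i=[A_i^{\rm in};A_i^{\rm eq}]$ has full row rank $m=m^{\rm in}+m^{\rm eq}$. Let $\tilde{\mathcal X}_i=\{x: g_i^j(x)<0\ \forall j\}$, and let $B_i^j$ be barrier functions: $B_i^j$ is convex and $C^2$ on $\tilde{\mathcal X}_i$, and $B_i^j(x)\to+\infty$ as $g_i^j(x)\to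 0$ from negative values. For $c>0$ put $F_i=f_i+c\sum_j B_i^j$. The barrier problem is $$\text{(B)}\quad \min\ \sum_i F_i(x_i)\quad\text{s.t. the coupling constraints and } x_i\in\tilde{\mathcal X}_i\ \forall i,$$ with optimal value $F^\star$. Write $b=(b^{\rm in},b^{\rm eq})$. For $y_i=(y_i^{\rm in},y_i^{\rm eq})\in\mathbb R^m$ let $\phi_i(y_i)\in[-\infty,+\infty]$ be the optimal value of $$\text{(S}_i)\quad \min_{x_i\in\tilde{\mathcal X}_i}F_i(x_i)\quad\text{s.t.}\quad A_i^{\rm in}x_i\le y_i^{\rm in},\quad A_i^{\rm eq}x_i=y_i^{\rm eq}.$$ **Algorithm (DRRA).** Start from $(y_i^0)_i$ with $\sum_i y_i^0=b$ and $\phi_i(y_i^0)<+\infty$ for all $i$, and let $x_i^0$ be an optimal solution of (S$_i$) with $y_i=y_i^0$. At iteration $k$ a random set $U_k\subseteq\mathcal V$ is formed such that the sets $\bar{\mathcal N}_i=\mathcal N_i\cup\{i\}$, $i\in U_k$, are pairwise disjoint. For each $i\in U_k$, $(x_j^{k+1})_{j\in\bar{\mathcal N}_i}$ is an optimal solution (any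 one, if there are several) of $$\min_{x_j\in\tilde{\mathcal X}_j,\,j\in\bar{\mathcal N}_i}\ \sum_{j\in\bar{\mathcal N}_i}F_j(x_j)\quad\text{s.t.}\quad \sum_{j\in\bar{\mathcal N}_i}A_j^{\rm in}x_j\le\sum_{j\in\bar{\mathcal N}_i}y_j^{{\rm in},k},\quad \sum_{j\in\bar{\mathcal N}_i}A_j^{\rm eq}x_j=\sum_{j\in\bar{\mathcal N}_i}y_j^{{\rm eq},k},$$ and for $j\in\bar{\mathcal N}_i$ $$y_j^{{\rm in},k+1}=A_j^{\rm in}x_j^{k+1}+\frac1{|\mathcal N_i|+1}\sum_{\ell\in\bar{\mathcal N}_i}\bigl(y_\ell^{{\rm in},k}-A_\ell^{\rm in}x_\ell^{k+1}\bigr),\qquad y_j^{{\rm eq},k+1}=A_j^{\rm eq}x_j^{k+1}.$$ For all other $j$, $x_j^{k+1}=x_j^k$ and $y_j^{k+1}=y_j^k$. Assume that for some $\tilde p>0$, for all $i\in\mathcal V$ and $k\ge0$, the conditional probability of $i\in U_k$ given $U_0,\dots,U_{k-1}$ is at least $\tilde p$. **Theorem.** The values $f^\star$ and $F^\star$ are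 finite. For every $c>0$, every iterate $(x_i^k)_{i\in\mathcal V}$, $k\ge0$, is feasible for both (B) and (P), and with probability $1$ $$\lim_{k\to\infty}\sum_{i\in\mathcal V}F_i(x_i^k)=F^\star .$$ Moreover, for every $\epsilon>0$ there is $\bar c>0$, depending only on $\epsilon$ and on the problem data $(f_i,g_i^j,B_i^j,A_i,b)$ and not on the run of the algorithm, such that for all $c\in(0,\bar c]$, with probability $1$, $$\limsup_{k\to\infty}\sum_{i\in\mathcal V}f_i(x_i^k)\le f^\star+\epsilon .$$ -/

import Mathlib

open Set Filter Topology MeasureTheory ProbabilityTheory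

noncomputable section

namespace DRRA

/-- The data of a resource allocation problem over the finite node set `V`: node `i` has the local
variable `x i ∈ ℝ^(d i)`, the objective `f i`, the local constraint functions `g i j` (`p i` of
them), a barrier function `B i j` for each local constraint, and the matrices `AIn i`, `AEq i` of
the coupling inequality and equality constraints with right-hand sides `bIn`, `bEq`.
Only data are recorded here. The space `ℝ^d` is `Fin d → ℝ`; only its topology, its linear structure
and differentiability are used, and these do not depend on the choice of a norm. -/
structure Problem (V : Type*) where
  d : V → ℕ
  p : V → ℕ
  mIn : ℕ
  mEq : ℕ
  f : ∀ i : V, (Fin (d i) → ℝ) → ℝ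
  g : ∀ i : V, Fin (p i) → (Fin (d i) → ℝ) → ℝ
  B : ∀ i : V, Fin (p i) → (Fin (d i) → ℝ) → ℝ
  AIn : ∀ i : V, Matrix (Fin mIn) (Fin (d i)) ℝ
  AEq : ∀ i : V, Matrix (Fin mEq) (Fin (d i)) ℝ
  bIn : Fin mIn → ℝ
  bEq : Fin mEq → ℝ

namespace Problem

variable {V : Type*} (P : Problem V)

/-- A family of local variables `(x_i)_{i ∈ V}`. -/
abbrev Point : Type _ := ∀ i : V, Fin (P.d i) → ℝ

/-- A right-hand side `y_i = (y_i^in, y_i^eq)`. -/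
abbrev Rhs : Type := (Fin P.mIn → ℝ) × (Fin P.mEq → ℝ)

/-- The local constraint set `𝒳_i`. -/
def localSet (i : V) : Set (Fin (P.d i) → ℝ) := {z | ∀ j, P.g i j z ≤ 0}

/-- The strict local constraint set, on which the barrier functions live. -/
def strictSet (i : V) : Set (Fin (P.d i) → ℝ) := {z | ∀ j, P.g i j z < 0}

/-- The barrier objective `F_i = f_i + c ∑_j B_i^j` of node `i`. -/
def F (c : ℝ) (i : V) (z : Fin (P.d i) → ℝ) : ℝ := P.f i z + c * ∑ j, P.B i j z

/-- The requirements on the barrier functions. -/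
structure IsBarrier : Prop where
  blowup : ∀ i j, Tendsto (P.B i j) (comap (P.g i j) (𝓝[<] 0)) atTop
  convex : ∀ i j, ConvexOn ℝ (P.strictSet i) (P.B i j)
  smooth : ∀ i j, ContDiffOn ℝ 2 (P.B i j) (P.strictSet i)

/-- Feasible set of the subproblem of node `i` with right-hand side `w`. -/
def subFeasible (i : V) (w : P.Rhs) : Set (Fin (P.d i) → ℝ) :=
  {z | z ∈ P.strictSet i ∧ (P.AIn i).mulVec z ≤ w.1 ∧ (P.AEq i).mulVec z = w.2}

/-- The primal function `φ_i`: the optimal value, in `[-∞, +∞]`, of the subproblem of node `i`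
(the infimum over the empty set is `+∞`). -/
def phi (c : ℝ) (i : V) (w : P.Rhs) : EReal := ⨅ z ∈ P.subFeasible i w, ((P.F c i z : ℝ) : EReal)

/-- `z` is an optimal solution of the subproblem of node `i` with right-hand side `w`. -/
def SubOptimal (c : ℝ) (i : V) (w : P.Rhs) (z : Fin (P.d i) → ℝ) : Prop :=
  z ∈ P.subFeasible i w ∧ ∀ z' ∈ P.subFeasible i w, P.F c i z ≤ P.F c i z'

variable [Fintype V]

/-- The coupling constraints. -/
def Coupling (x : P.Point) : Prop :=
  ∑ i, (P.AIn i).mulVec (x i) ≤ P.bIn ∧ ∑ i, (P.AEq i).mulVec (x i) = P.bEq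

/-- Feasible set of the original problem. -/
def feasible : Set P.Point := {x | (∀ i, x i ∈ P.localSet i) ∧ P.Coupling x}

/-- Feasible set of the barrier problem. -/
def barrierFeasible : Set P.Point := {x | (∀ i, x i ∈ P.strictSet i) ∧ P.Coupling x}

/-- The optimal value `f⋆` of the original problem, in `[-∞, +∞]`. -/
def optVal : EReal := ⨅ x ∈ P.feasible, ((∑ i, P.f i (x i) : ℝ) : EReal)

/-- The optimal value `F⋆` of the barrier problem, in `[-∞, +∞]`. -/
def barrierOptVal (c : ℝ) : EReal :=
  ⨅ x ∈ P.barrierFeasible, ((∑ i, P.F c i (x i) : ℝ) : EReal)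

/-- The standing assumption on the problem. -/
structure Regular : Prop where
  f_convex : ∀ i, ConvexOn ℝ (P.localSet i) (P.f i)
  f_smooth : ∀ i, ContDiffOn ℝ 2 (P.f i) (P.localSet i)
  g_convex : ∀ i j, ConvexOn ℝ univ (P.g i j)
  g_smooth : ∀ i j, ContDiff ℝ 2 (P.g i j)
  slater : ∃ x : P.Point, (∀ i j, P.g i j (x i) < 0) ∧ P.Coupling x
  compact : IsCompact P.feasible
  full_row_rank : ∀ i, (Matrix.fromRows (P.AIn i) (P.AEq i)).rank = P.mIn + P.mEq

/-- `y` is feasible for the problem of minimizing `∑ φ_i(y_i)` subject to `∑ y_i = b`. -/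
def AllocFeasible (c : ℝ) (y : V → P.Rhs) : Prop :=
  ∑ i, y i = (P.bIn, P.bEq) ∧ ∀ i, P.phi c i (y i) < ⊤

open Classical in
/-- The closed neighborhood `𝒩_i ∪ {i}`; its cardinality is `|𝒩_i| + 1`. -/
def closedNbhd (G : SimpleGraph V) (i : V) : Finset V :=
  Finset.univ.filter fun j => j = i ∨ G.Adj i j

/-- Feasibility for the local reallocation problem around node `i` with current allocation `y`.
Only the components `x j` with `j ∈ 𝒩_i ∪ {i}` matter. -/
def BlockFeasible (G : SimpleGraph V) (i : V) (y : V → P.Rhs) (x : P.Point) : Prop :=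
  (∀ j ∈ closedNbhd G i, x j ∈ P.strictSet j) ∧
  ∑ j ∈ closedNbhd G i, (P.AIn j).mulVec (x j) ≤ ∑ j ∈ closedNbhd G i, (y j).1 ∧
  ∑ j ∈ closedNbhd G i, (P.AEq j).mulVec (x j) = ∑ j ∈ closedNbhd G i, (y j).2

/-- `(x j)_{j ∈ 𝒩_i ∪ {i}}` solves the local reallocation problem around node `i`. -/
def BlockOptimal (c : ℝ) (G : SimpleGraph V) (i : V) (y : V → P.Rhs) (x : P.Point) : Prop :=
  P.BlockFeasible G i y x ∧ ∀ x', P.BlockFeasible G i y x' →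
    ∑ j ∈ closedNbhd G i, P.F c j (x j) ≤ ∑ j ∈ closedNbhd G i, P.F c j (x' j)

/-- `(x^k, y^k)` is a sequence generated by the distributed resource reallocation algorithm with
update sets `U_k`, started from a feasible `y^0`. Where a minimization problem has several
optimal solutions, any of them may be taken. -/
structure IsRun (c : ℝ) (G : SimpleGraph V) (U : ℕ → Finset V)
    (x : ℕ → P.Point) (y : ℕ → V → P.Rhs) : Prop where
  init_y : P.AllocFeasible c (y 0)
  init_x : ∀ i, P.SubOptimal c i (y 0 i) (x 0 i)
  nonconflict : ∀ k, ∀ i ∈ U k, ∀ j ∈ U k, i ≠ j → Disjoint (closedNbhd G i) (closedNbhd G j)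
  update_x : ∀ k, ∀ i ∈ U k, P.BlockOptimal c G i (y k) (x (k + 1))
  update_y_in : ∀ k, ∀ i ∈ U k, ∀ j ∈ closedNbhd G i,
    (y (k + 1) j).1 = (P.AIn j).mulVec (x (k + 1) j) +
      (1 / ((closedNbhd G i).card : ℝ)) •
        ∑ l ∈ closedNbhd G i, ((y k l).1 - (P.AIn l).mulVec (x (k + 1) l))
  update_y_eq : ∀ k, ∀ i ∈ U k, ∀ j ∈ closedNbhd G i,
    (y (k + 1) j).2 = (P.AEq j).mulVec (x (k + 1) j)
  idle : ∀ k j, (∀ i ∈ U k, j ∉ closedNbhd G i) → x (k + 1) j = x k j ∧ y (k + 1) j = y k j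

end Problem

/-- The assumption on the random selection of the update sets: for some `q > 0`, at every iteration
`k` and whatever the past update sets `U_0, …, U_{k-1}` were, each node belongs to `U_k` with
(conditional) probability at least `q`. -/
def SelectionAssumption {V Ω : Type*} [MeasurableSpace Ω] (μ : Measure Ω)
    (U : ℕ → Ω → Finset V) : Prop :=
  (∀ k s, MeasurableSet {ω | U k ω = s}) ∧
  ∃ q : ℝ, 0 < q ∧ ∀ (k : ℕ) (i : V) (u : ℕ → Finset V),
    μ {ω | ∀ t < k, U t ω = u t} ≠ 0 →
      q ≤ (μ[|{ω | ∀ t < k, U t ω = u t}]).real {ω | i ∈ U k ω}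

end DRRA

end

/-! The algorithm equalizes Lagrange multipliers over closed neighborhoods, while convexity keeps
them from drifting between updates.

Each node carries a multiplier certifying its current `x` and `y`. An optimal block has one
multiplier for all its nodes, and the equal split of the block slack preserves complementarity at
each of them (`IsRun.exists_block_isMultiplier`). Complementarity also shows that one update lowers
the total barrier objective by at least the Bregman distance from the new to the old iterate at
every node (`IsRun.bregman_le`). The objective is thus monotone and bounded below, so these
distances tend to zero.

By barrier blow-up and compactness, all iterates stay in fixed compact subsets of the open strict
sets (`Regular.exists_compact`). There vanishing Bregman distances force vanishing gradient
differences, without strict convexity (`tendsto_fderiv_sub_of_bregman`). Full row rank makes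
multipliers linear images of gradients, so the one-step changes of the multipliers vanish too.

Almost surely some list of all the nodes is selected in consecutive steps infinitely often
(`ae_frequently_window`). Within such a window of fixed length the multipliers barely move, yet each
node agrees with its neighbors at some time. By connectivity all multipliers agree asymptotically
along the window starts. Weak duality with the nearly common multiplier, and bounded allocations,
bound the limit of the objective by the value of every barrier-feasible point.

For the original problem, a Slater perturbation of a nearly optimal point has finite barrier cost.
Barriers are bounded below on barrier-feasible points, so a small `c` makes their effect negligible.
-/

noncomputable section

namespace DRRA

/-! ### Convex analysis: gradients, multipliers and Bregman distances -/

section Convex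

variable {E W : Type*} [NormedAddCommGroup E] [NormedSpace ℝ E]
  [NormedAddCommGroup W] [NormedSpace ℝ W]

/-- The gradient inequality for convex functions. -/
theorem convexOn_add_fderiv_le {S : Set E} {F : E → ℝ} {F' : E →L[ℝ] ℝ} {x z : E}
    (hF : ConvexOn ℝ S F) (hx : x ∈ S) (hz : z ∈ S) (hd : HasFDerivAt F F' x) :
    F x + F' (z - x) ≤ F z := by
  have hl : HasDerivAt (fun t : ℝ => F (x + t • (z - x))) (F' (z - x)) 0 := by
    have h1 : HasDerivAt (fun t : ℝ => x + t • (z - x)) (z - x) 0 := by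
      simpa using ((hasDerivAt_id (0 : ℝ)).smul_const (z - x)).const_add x
    have h2 : HasFDerivAt F F' (x + (0 : ℝ) • (z - x)) := by simpa using hd
    exact h2.comp_hasDerivAt (0 : ℝ) h1
  have ht : Tendsto (fun t : ℝ => t⁻¹ * (F (x + t • (z - x)) - F x)) (𝓝[>] 0)
      (𝓝 (F' (z - x))) := by
    have := hl.tendsto_slope_zero_right
    simpa using this
  have hle : F' (z - x) ≤ F z - F x := by
    refine le_of_tendsto ht ?_
    have h01 : Ioo (0 : ℝ) 1 ∈ 𝓝[>] (0 : ℝ) := Ioo_mem_nhdsGT one_pos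
    filter_upwards [h01] with t ht
    have hc := hF.2 hx hz (sub_nonneg.2 ht.2.le) ht.1.le (by ring)
    have he : (1 - t) • x + t • z = x + t • (z - x) := by
      rw [sub_smul, one_smul, smul_sub]; abel
    rw [he] at hc
    simp only [smul_eq_mul] at hc
    rw [inv_mul_le_iff₀ ht.1]
    linarith
  linarith

/-- First-order optimality conditions for minimizing `F` over an open set subject to the conic
constraint `w - A z ∈ C`, where `A` has a right inverse. -/
theorem exists_multiplier {S : Set E} {F : E → ℝ} {F' : E →L[ℝ] ℝ} {A : E →L[ℝ] W}
    {R : W →L[ℝ] E} {C : Set W} {x : E} {w : W} (hAR : ∀ s, A (R s) = s)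
    (hadd : ∀ s ∈ C, ∀ t ∈ C, s + t ∈ C) (hsmul : ∀ a : ℝ, 0 ≤ a → ∀ s ∈ C, a • s ∈ C)
    (hS : IsOpen S) (hx : x ∈ S) (hxC : w - A x ∈ C) (hd : HasFDerivAt F F' x)
    (hmin : ∀ z ∈ S, w - A z ∈ C → F x ≤ F z) :
    ∃ l : W →L[ℝ] ℝ, F' = -(l.comp A) ∧ (∀ s ∈ C, 0 ≤ l s) ∧ l (w - A x) = 0 := by
  set T : Set E := {z | w - A z ∈ C} with hT
  have hloc : IsLocalMinOn F T x := by
    filter_upwards [mem_nhdsWithin_of_mem_nhds (hS.mem_nhds hx), self_mem_nhdsWithin] with z h1 h2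
    exact hmin z h1 h2
  -- Only the conic constraint has to hold along the segment: `S` is open, so `x` is a local
  -- minimizer over `T` alone.
  have hdir : ∀ h : E, (∀ t : ℝ, 0 ≤ t → t ≤ 1 → w - A x - t • A h ∈ C) → 0 ≤ F' h := by
    intro h hh
    refine hloc.hasFDerivWithinAt_nonneg hd.hasFDerivWithinAt
      (mem_posTangentConeAt_of_segment_subset ?_)
    rw [segment_eq_image']
    rintro _ ⟨t, ht, rfl⟩
    have := hh t ht.1 ht.2
    simpa [hT, sub_sub] using this
  have hker : ∀ h : E, A h = 0 → F' h = 0 := by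
    intro h hh
    have h1 : 0 ≤ F' h := hdir h fun t _ _ => by simpa [hh] using hxC
    have h2 : 0 ≤ F' (-h) := hdir (-h) fun t _ _ => by simpa [hh] using hxC
    rw [map_neg] at h2
    linarith
  -- Moving along `-R s` adds multiples of `s` to the slack.
  have hpos : ∀ s ∈ C, 0 ≤ -F' (R s) := by
    intro s hs
    have := hdir (-(R s)) fun t h0 _ => by
      simpa [hAR] using hadd _ hxC _ (hsmul t h0 s hs)
    simpa using this
  refine ⟨-(F'.comp R), ?_, ?_, ?_⟩
  · ext h
    have := hker (h - R (A h)) (by simp [hAR])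
    rw [map_sub] at this
    simp only [neg_apply, ContinuousLinearMap.comp_apply, neg_neg]
    linarith
  · intro s hs
    simpa using hpos s hs
  · have h1 := hpos _ hxC
    -- Moving along `R (w - A x)` shrinks the slack by the factor `1 - t`, which stays in the cone;
    -- this is the inequality opposite to `h1`.
    have h2 : 0 ≤ F' (R (w - A x)) := hdir _ fun t _ h1 => by
      have := hsmul (1 - t) (by linarith) _ hxC
      rw [hAR]
      rwa [sub_smul, one_smul] at this
    simp only [neg_apply, ContinuousLinearMap.comp_apply]
    linarith

/-- On a compact set, if the Bregman distances of a smooth convex function tend to zero then so do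
the differences of the gradients. -/
theorem tendsto_fderiv_sub_of_bregman {S K : Set E} {F : E → ℝ} (hF : ConvexOn ℝ S F)
    (hS : IsOpen S) (hd : DifferentiableOn ℝ F S) (hc : ContinuousOn (fderiv ℝ F) S)
    (hK : IsCompact K) (hKS : K ⊆ S) {u v : ℕ → E} (hu : ∀ n, u n ∈ K) (hv : ∀ n, v n ∈ K)
    (hD : Tendsto (fun n => F (u n) - F (v n) - fderiv ℝ F (v n) (u n - v n)) atTop (𝓝 0)) :
    Tendsto (fun n => fderiv ℝ F (u n) - fderiv ℝ F (v n)) atTop (𝓝 0) := by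
  refine tendsto_of_subseq_tendsto fun ns hns => ?_
  obtain ⟨⟨a, b⟩, ⟨ha, hb⟩, φ, hφ, hab⟩ :=
    (hK.prod hK).tendsto_subseq (x := fun n => (u (ns n), v (ns n))) fun n => ⟨hu _, hv _⟩
  have hua : Tendsto (fun n => u (ns (φ n))) atTop (𝓝 a) := (continuous_fst.tendsto _).comp hab
  have hvb : Tendsto (fun n => v (ns (φ n))) atTop (𝓝 b) := (continuous_snd.tendsto _).comp hab
  have hFc : ∀ z ∈ K, ContinuousAt F z := fun z hz =>
    (hd.differentiableAt (hS.mem_nhds (hKS hz))).continuousAt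
  have hGc : ∀ z ∈ K, ContinuousAt (fderiv ℝ F) z := fun z hz =>
    hc.continuousAt (hS.mem_nhds (hKS hz))
  have hda : ∀ z ∈ K, HasFDerivAt F (fderiv ℝ F z) z := fun z hz =>
    (hd.differentiableAt (hS.mem_nhds (hKS hz))).hasFDerivAt
  have hFu := (hFc a ha).tendsto.comp hua
  have hFv := (hFc b hb).tendsto.comp hvb
  have hGu := (hGc a ha).tendsto.comp hua
  have hGv := (hGc b hb).tendsto.comp hvb
  have hlim : F a - F b - fderiv ℝ F b (a - b) = 0 := by
    have h1 := hD.comp (hns.comp hφ.tendsto_atTop)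
    exact tendsto_nhds_unique ((hFu.sub hFv).sub ((isBoundedBilinearMap_apply.continuous.tendsto (fderiv ℝ F b, a - b)).comp
      (hGv.prodMk_nhds (hua.sub hvb)))) h1
  -- Zero Bregman distance means that `a` minimizes `F` minus its linearization at `b`, so the
  -- gradients coincide even if `a ≠ b`.
  have heq : fderiv ℝ F a = fderiv ℝ F b := by
    have hmin : IsLocalMin (fun z => F z - fderiv ℝ F b z) a := by
      filter_upwards [hS.mem_nhds (hKS ha)] with z hz
      have := convexOn_add_fderiv_le hF (hKS hb) hz (hda b hb)
      rw [map_sub] at this hlim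
      linarith
    have := hmin.hasFDerivAt_eq_zero ((hda a ha).sub (fderiv ℝ F b).hasFDerivAt)
    exact sub_eq_zero.1 this
  refine ⟨φ, ?_⟩
  have := hGu.sub hGv
  rw [heq, sub_self] at this
  exact this

end Convex

/-! ### Random selection: every finite word of nodes recurs almost surely -/

section Selection

variable {V Ω : Type*} {U : ℕ → Ω → Finset V}

/-- The event `E` is determined by the update sets `U_0, …, U_{k-1}`. -/
def DeterminedBy (U : ℕ → Ω → Finset V) (k : ℕ) (E : Set Ω) : Prop :=
  ∀ ω ω', (∀ t < k, U t ω = U t ω') → ω ∈ E → ω' ∈ E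

theorem DeterminedBy.mono {k l : ℕ} {E : Set Ω} (hE : DeterminedBy U k E) (hkl : k ≤ l) :
    DeterminedBy U l E :=
  fun ω ω' h => hE ω ω' fun t ht => h t (ht.trans_le hkl)

theorem DeterminedBy.inter {k : ℕ} {E E' : Set Ω} (hE : DeterminedBy U k E)
    (hE' : DeterminedBy U k E') : DeterminedBy U k (E ∩ E') :=
  fun ω ω' h hω => ⟨hE ω ω' h hω.1, hE' ω ω' h hω.2⟩

theorem DeterminedBy.compl {k : ℕ} {E : Set Ω} (hE : DeterminedBy U k E) :
    DeterminedBy U k Eᶜ :=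
  fun ω ω' h hω hω' => hω (hE ω' ω (fun t ht => (h t ht).symm) hω')

theorem determinedBy_mem (k : ℕ) (i : V) : DeterminedBy U (k + 1) {ω | i ∈ U k ω} := by
  intro ω ω' h hω
  have := h k (Nat.lt_succ_self k)
  simp only [mem_ofPred_eq] at hω ⊢
  rwa [← this]

/-- The nodes `w 0, …, w (n - 1)` are selected at the times `k, …, k + n - 1`. -/
def windowEvent (U : ℕ → Ω → Finset V) (w : ℕ → V) (k n : ℕ) : Set Ω :=
  {ω | ∀ t < n, w t ∈ U (k + t) ω}

theorem windowEvent_succ (w : ℕ → V) (k n : ℕ) :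
    windowEvent U w k (n + 1) = windowEvent U w k n ∩ {ω | w n ∈ U (k + n) ω} := by
  ext ω
  simp only [windowEvent, mem_ofPred_eq, mem_inter_iff]
  exact Nat.forall_lt_succ_right

theorem determinedBy_windowEvent (w : ℕ → V) (k n : ℕ) :
    DeterminedBy U (k + n) (windowEvent U w k n) := by
  induction n with
  | zero => intro ω ω' _ _ t ht; omega
  | succ n ih =>
    rw [windowEvent_succ]
    exact (ih.mono (by omega)).inter (determinedBy_mem (k + n) (w n))

/-- None of the first `m` consecutive windows of length `n` after time `k` matches `w`. -/
def missEvent (U : ℕ → Ω → Finset V) (w : ℕ → V) (k n m : ℕ) : Set Ω :=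
  {ω | ∀ r < m, ω ∉ windowEvent U w (k + r * n) n}

theorem missEvent_succ (w : ℕ → V) (k n m : ℕ) :
    missEvent U w k n (m + 1) = missEvent U w k n m ∩ (windowEvent U w (k + m * n) n)ᶜ := by
  ext ω
  simp only [missEvent, mem_ofPred_eq, mem_inter_iff, mem_compl_iff]
  exact Nat.forall_lt_succ_right

theorem determinedBy_missEvent (w : ℕ → V) (k n m : ℕ) :
    DeterminedBy U (k + m * n) (missEvent U w k n m) := by
  induction m with
  | zero => intro ω ω' _ _ t ht; omega
  | succ m ih =>
    rw [missEvent_succ]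
    have e : k + (m + 1) * n = k + m * n + n := by ring
    rw [e]
    exact (ih.mono (by omega)).inter (determinedBy_windowEvent w _ n).compl

/-- The cylinder of a finite history, extended by `∅`. -/
def cylinder (U : ℕ → Ω → Finset V) (k : ℕ) (u : Fin k → Finset V) : Set Ω :=
  {ω | ∀ t < k, U t ω = if h : t < k then u ⟨t, h⟩ else ∅}

theorem mem_cylinder_iff {k : ℕ} {u : Fin k → Finset V} {ω : Ω} :
    ω ∈ cylinder U k u ↔ (fun t : Fin k => U t ω) = u := by
  constructor
  · intro h
    funext t
    have := h t t.2
    simpa using this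
  · rintro rfl t ht
    simp [ht]

variable [MeasurableSpace Ω]

theorem measurableSet_cylinder (hU : ∀ k s, MeasurableSet {ω | U k ω = s}) (k : ℕ)
    (u : ℕ → Finset V) : MeasurableSet {ω | ∀ t < k, U t ω = u t} := by
  simp only [ofPred_forall]
  exact MeasurableSet.iInter fun t => MeasurableSet.iInter fun _ => hU t _

variable [Fintype V]

theorem DeterminedBy.measurableSet (hU : ∀ k s, MeasurableSet {ω | U k ω = s}) {k : ℕ}
    {E : Set Ω} (hE : DeterminedBy U k E) : MeasurableSet E := by
  have : E = ⋃ u ∈ {u : Fin k → Finset V | (cylinder U k u ∩ E).Nonempty}, cylinder U k u := by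
    ext ω
    simp only [mem_iUnion, mem_ofPred_eq, exists_prop]
    constructor
    · intro h
      exact ⟨_, ⟨ω, mem_cylinder_iff.2 rfl, h⟩, mem_cylinder_iff.2 rfl⟩
    · rintro ⟨u, ⟨ω', h1, h2⟩, h3⟩
      exact hE ω' ω (fun t ht => (h1 t ht).trans (h3 t ht).symm) h2
  rw [this]
  exact MeasurableSet.biUnion (Set.to_countable _) fun u _ => measurableSet_cylinder hU k _

variable {μ : Measure Ω} [IsProbabilityMeasure μ]

theorem measureReal_eq_sum_cylinder (hU : ∀ k s, MeasurableSet {ω | U k ω = s}) (k : ℕ)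
    (E : Set Ω) :
    μ.real E = ∑ u : Fin k → Finset V, μ.real (E ∩ cylinder U k u) := by
  classical
  have hd : Pairwise (Function.onFun Disjoint fun u : Fin k → Finset V => cylinder U k u) := by
    intro u v huv
    refine Set.disjoint_left.2 fun ω h1 h2 => huv ?_
    rw [mem_cylinder_iff] at h1 h2
    exact h1.symm.trans h2
  have hu : (⋃ u : Fin k → Finset V, cylinder U k u) = univ := by
    ext ω
    simpa using ⟨_, mem_cylinder_iff.2 rfl⟩
  -- Restricting the measure to `E` needs only the cylinders to be measurable, not `E`.
  have h := measure_iUnion (μ := μ.restrict E) hd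
    fun u => measurableSet_cylinder hU k _
  rw [hu, Measure.restrict_apply_univ, tsum_fintype] at h
  rw [Measure.real, h, ENNReal.toReal_sum (fun u _ => measure_ne_top _ _)]
  refine Finset.sum_congr rfl fun u _ => ?_
  have hm : MeasurableSet (cylinder U k u) := measurableSet_cylinder hU k _
  rw [Measure.restrict_apply hm, inter_comm]
  rfl

/-- Conditionally on any event of the past, each node is selected with probability at least `q`. -/
theorem mul_measureReal_le_inter_mem (hU : ∀ k s, MeasurableSet {ω | U k ω = s}) {q : ℝ}
    (hq : ∀ (k : ℕ) (i : V) (u : ℕ → Finset V), μ {ω | ∀ t < k, U t ω = u t} ≠ 0 →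
      q ≤ (μ[|{ω | ∀ t < k, U t ω = u t}]).real {ω | i ∈ U k ω})
    {k : ℕ} {E : Set Ω} (hE : DeterminedBy U k E) (i : V) :
    q * μ.real E ≤ μ.real (E ∩ {ω | i ∈ U k ω}) := by
  rw [measureReal_eq_sum_cylinder hU k E, measureReal_eq_sum_cylinder hU k (E ∩ _),
    Finset.mul_sum]
  refine Finset.sum_le_sum fun u _ => ?_
  by_cases hne : (cylinder U k u ∩ E).Nonempty
  · obtain ⟨ω', h1, h2⟩ := hne
    have hsub : cylinder U k u ⊆ E := fun ω h3 =>
      hE ω' ω (fun t ht => (h1 t ht).trans (h3 t ht).symm) h2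
    have e1 : E ∩ cylinder U k u = cylinder U k u := inter_eq_right.2 hsub
    have e2 : E ∩ {ω | i ∈ U k ω} ∩ cylinder U k u = cylinder U k u ∩ {ω | i ∈ U k ω} := by
      ext ω
      constructor
      · rintro ⟨⟨_, h⟩, h'⟩
        exact ⟨h', h⟩
      · rintro ⟨h', h⟩
        exact ⟨⟨hsub h', h⟩, h'⟩
    rw [e1, e2]
    -- The selection assumption says nothing about null histories, but these contribute zero to both
    -- sides.
    by_cases h0 : μ (cylinder U k u) = 0
    · simp [Measure.real, h0]
    · have h := hq k i _ h0
      have hm : MeasurableSet (cylinder U k u) := measurableSet_cylinder hU k _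
      have hc := cond_apply hm μ {ω | i ∈ U k ω}
      have hpos : 0 < μ.real (cylinder U k u) :=
        ENNReal.toReal_pos h0 (measure_ne_top _ _)
      have hc' : (μ[|cylinder U k u]).real {ω | i ∈ U k ω} =
          (μ.real (cylinder U k u))⁻¹ * μ.real (cylinder U k u ∩ {ω | i ∈ U k ω}) := by
        rw [Measure.real, hc, ENNReal.toReal_mul, ENNReal.toReal_inv]
        rfl
      change q ≤ (μ[|cylinder U k u]).real _ at h
      rw [hc', le_inv_mul_iff₀ hpos] at h
      linarith
  · have e1 : E ∩ cylinder U k u = ∅ := by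
      rw [inter_comm]
      exact not_nonempty_iff_eq_empty.1 hne
    have e2 : E ∩ {ω | i ∈ U k ω} ∩ cylinder U k u = ∅ := by
      rw [inter_right_comm, e1, empty_inter]
    rw [e1, e2]
    simp

/-- The part of the window already matched is itself a past event, so each further selection costs
one more factor `q`. -/
theorem pow_mul_measureReal_le_inter_window (hU : ∀ k s, MeasurableSet {ω | U k ω = s}) {q : ℝ}
    (hq0 : 0 ≤ q)
    (hq : ∀ (k : ℕ) (i : V) (u : ℕ → Finset V), μ {ω | ∀ t < k, U t ω = u t} ≠ 0 →
      q ≤ (μ[|{ω | ∀ t < k, U t ω = u t}]).real {ω | i ∈ U k ω})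
    {k : ℕ} {E : Set Ω} (hE : DeterminedBy U k E) (w : ℕ → V) (n : ℕ) :
    q ^ n * μ.real E ≤ μ.real (E ∩ windowEvent U w k n) := by
  induction n with
  | zero =>
    have : windowEvent U w k 0 = univ := by
      ext ω; simp [windowEvent]
    simp [this]
  | succ n ih =>
    have hE' : DeterminedBy U (k + n) (E ∩ windowEvent U w k n) :=
      (hE.mono (by omega)).inter (determinedBy_windowEvent w k n)
    have h := mul_measureReal_le_inter_mem hU hq hE' (w n)
    rw [inter_assoc, ← windowEvent_succ] at h
    calc q ^ (n + 1) * μ.real E = q * (q ^ n * μ.real E) := by ring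
      _ ≤ q * μ.real (E ∩ windowEvent U w k n) := mul_le_mul_of_nonneg_left ih hq0
      _ ≤ _ := h

/-- Almost surely every finite word of nodes is matched by infinitely many windows of update
sets. -/
theorem ae_frequently_window (h : SelectionAssumption μ U) (w : ℕ → V) (n : ℕ) :
    ∀ᵐ ω ∂μ, ∃ᶠ k in atTop, ∀ t < n, w t ∈ U (k + t) ω := by
  obtain ⟨hU, q, hq0, hq⟩ := h
  rcases Nat.eq_zero_or_pos n with rfl | hn
  · refine Eventually.of_forall fun ω => ?_
    simp only [not_lt_zero, false_imp_iff, implies_true]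
    exact frequently_const.2 trivial
  -- Conditioning on the empty history at time `0` bounds `q` by a probability.
  have hq1 : q ≤ 1 := by
    have h0 : {ω : Ω | ∀ t < 0, U t ω = (fun _ => ∅ : ℕ → Finset V) t} = univ := by
      ext ω; simp
    have := hq 0 (w 0) (fun _ => ∅) (by rw [h0]; simp)
    rw [h0, cond_univ] at this
    exact this.trans measureReal_le_one
  have hr0 : 0 ≤ 1 - q ^ n := sub_nonneg.2 (pow_le_one₀ hq0.le hq1)
  have hr1 : 1 - q ^ n < 1 := by
    have := pow_pos hq0 n
    linarith
  -- The windows do not overlap, so earlier misses belong to the past of the next window, which is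
  -- matched with conditional probability at least `q ^ n`.
  have hbound : ∀ k m, μ.real (missEvent U w k n m) ≤ (1 - q ^ n) ^ m := by
    intro k m
    induction m with
    | zero => simp
    | succ m ih =>
      have hd := determinedBy_missEvent (U := U) w k n m
      have h1 := pow_mul_measureReal_le_inter_window (μ := μ) hU hq0.le hq hd w n
      have h2 := measureReal_inter_add_sdiff (μ := μ) (s := missEvent U w k n m)
        ((determinedBy_windowEvent (U := U) w (k + m * n) n).measurableSet hU)
      rw [missEvent_succ, ← sdiff_eq, pow_succ]
      nlinarith
  have hnull : ∀ k, μ {ω | ∀ r, ω ∉ windowEvent U w (k + r * n) n} = 0 := by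
    intro k
    have hle : μ.real {ω | ∀ r, ω ∉ windowEvent U w (k + r * n) n} ≤ 0 := by
      refine ge_of_tendsto' (tendsto_pow_atTop_nhds_zero_of_lt_one hr0 hr1) fun m => ?_
      have hsub : {ω | ∀ r, ω ∉ windowEvent U w (k + r * n) n} ⊆ missEvent U w k n m :=
        fun ω hω r _ => hω r
      exact (measureReal_mono hsub).trans (hbound k m)
    exact (measureReal_eq_zero_iff).1 (le_antisymm hle measureReal_nonneg)
  have hall : ∀ᵐ ω ∂μ, ∀ k, ∃ r, ω ∈ windowEvent U w (k + r * n) n := by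
    rw [ae_all_iff]
    intro k
    have := hnull k
    rw [ae_iff]
    simpa using this
  filter_upwards [hall] with ω hω
  rw [frequently_atTop]
  intro k
  obtain ⟨r, hr⟩ := hω k
  exact ⟨k + r * n, by omega, hr⟩

end Selection

namespace Problem

/-! ### Coupling maps, the slack cone and barrier blow-up -/

section Data

variable {V : Type*} (P : Problem V)

/-- The stacked coupling matrix of node `i`, as a continuous linear map. -/
def couplingMap (i : V) : (Fin (P.d i) → ℝ) →L[ℝ] P.Rhs :=
  LinearMap.toContinuousLinearMap ((P.AIn i).mulVecLin.prod (P.AEq i).mulVecLin)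

theorem couplingMap_apply (i : V) (z : Fin (P.d i) → ℝ) :
    P.couplingMap i z = ((P.AIn i).mulVec z, (P.AEq i).mulVec z) := rfl

/-- The cone of admissible slacks. -/
def slackCone : Set P.Rhs := {w | 0 ≤ w.1 ∧ w.2 = 0}

variable {P}

theorem sub_mem_slackCone_iff {v w : P.Rhs} :
    v - w ∈ P.slackCone ↔ w.1 ≤ v.1 ∧ w.2 = v.2 := by
  simp only [slackCone, mem_ofPred_eq, Prod.fst_sub, Prod.snd_sub, sub_nonneg, sub_eq_zero]
  exact and_congr_right fun _ => eq_comm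

theorem zero_mem_slackCone : (0 : P.Rhs) ∈ P.slackCone := ⟨le_rfl, rfl⟩

theorem add_mem_slackCone : ∀ s ∈ P.slackCone, ∀ t ∈ P.slackCone, s + t ∈ P.slackCone :=
  fun s hs t ht => ⟨add_nonneg hs.1 ht.1, by rw [Prod.snd_add, hs.2, ht.2, add_zero]⟩

theorem sum_mem_slackCone {ι : Type*} {s : Finset ι} {w : ι → P.Rhs}
    (h : ∀ i ∈ s, w i ∈ P.slackCone) : ∑ i ∈ s, w i ∈ P.slackCone := by
  classical
  induction s using Finset.induction_on with
  | empty => simpa using zero_mem_slackCone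
  | insert a s ha ih =>
    rw [Finset.sum_insert ha]
    exact add_mem_slackCone _ (h a (Finset.mem_insert_self a s)) _
      (ih fun i hi => h i (Finset.mem_insert_of_mem hi))

theorem smul_mem_slackCone : ∀ a : ℝ, 0 ≤ a → ∀ s ∈ P.slackCone, a • s ∈ P.slackCone :=
  fun a ha s hs => ⟨smul_nonneg ha hs.1, by rw [Prod.smul_snd, hs.2, smul_zero]⟩

theorem mem_subFeasible_iff {i : V} {w : P.Rhs} {z : Fin (P.d i) → ℝ} :
    z ∈ P.subFeasible i w ↔ z ∈ P.strictSet i ∧ w - P.couplingMap i z ∈ P.slackCone := by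
  rw [sub_mem_slackCone_iff, couplingMap_apply]
  rfl

theorem blockFeasible_iff [Fintype V] {G : SimpleGraph V} {i : V} {y : V → P.Rhs}
    {x : P.Point} :
    P.BlockFeasible G i y x ↔ (∀ j ∈ closedNbhd G i, x j ∈ P.strictSet j) ∧
      ∑ j ∈ closedNbhd G i, y j - ∑ j ∈ closedNbhd G i, P.couplingMap j (x j) ∈ P.slackCone := by
  rw [sub_mem_slackCone_iff]
  simp only [couplingMap_apply, Prod.fst_sum, Prod.snd_sum]
  rfl

theorem coupling_iff [Fintype V] {x : P.Point} :
    P.Coupling x ↔ ((P.bIn, P.bEq) : P.Rhs) - ∑ j, P.couplingMap j (x j) ∈ P.slackCone := by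
  rw [sub_mem_slackCone_iff]
  simp only [couplingMap_apply, Prod.fst_sum, Prod.snd_sum]
  rfl

theorem strictSet_subset_localSet (i : V) : P.strictSet i ⊆ P.localSet i :=
  fun _ hz j => (hz j).le

/-- A vector squeezed by two slacks is bounded by their sum. -/
theorem norm_le_of_mem_slackCone {s t : P.Rhs} (hs : s ∈ P.slackCone)
    (ht : t - s ∈ P.slackCone) : ‖s‖ ≤ ‖t‖ := by
  have h2 : s.2 = t.2 := (sub_mem_slackCone_iff.1 ht).2
  have h1 : s.1 ≤ t.1 := (sub_mem_slackCone_iff.1 ht).1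
  refine max_le_max ?_ (by rw [h2])
  refine (pi_norm_le_iff_of_nonneg (norm_nonneg _)).2 fun r => ?_
  refine le_trans ?_ (norm_le_pi_norm t.1 r)
  rw [Real.norm_of_nonneg (hs.1 r), Real.norm_of_nonneg ((hs.1 r).trans (h1 r))]
  exact h1 r

/-- The contrapositive of blow-up: a bound on the barrier keeps the point a definite distance inside
the constraint. -/
theorem IsBarrier.exists_pos_le_neg (hB : P.IsBarrier) (i : V) (j : Fin (P.p i)) (M : ℝ) :
    ∃ δ > 0, ∀ z ∈ P.strictSet i, P.B i j z ≤ M → P.g i j z ≤ -δ := by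
  have h := (hB.blowup i j).eventually_gt_atTop M
  rw [eventually_comap] at h
  obtain ⟨a, ha, h⟩ := mem_nhdsLT_iff_exists_Ioo_subset.1 h
  refine ⟨-a, neg_pos.2 ha, fun z hz hM => ?_⟩
  by_contra hlt
  rw [not_le, neg_neg] at hlt
  exact absurd hM (not_le.2 (h ⟨hlt, hz j⟩ z rfl))

end Data

/-! ### Smoothness, convexity and compactness from the standing assumptions -/

section RegularFacts

variable {V : Type*} [Fintype V] {P : Problem V}

/-- This is where full row rank enters. A right inverse realizes every slack direction, replacing a
constraint qualification, and recovers the multiplier from the gradient. -/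
theorem Regular.exists_rightInverse (hP : P.Regular) (i : V) :
    ∃ R : P.Rhs →L[ℝ] (Fin (P.d i) → ℝ), ∀ s, P.couplingMap i (R s) = s := by
  have hr := hP.full_row_rank i
  have htop : LinearMap.range (Matrix.fromRows (P.AIn i) (P.AEq i)).mulVecLin = ⊤ := by
    apply Submodule.eq_top_of_finrank_eq
    rw [Matrix.rank] at hr
    rw [hr]
    simp
  have hsurj : LinearMap.range
      ((P.AIn i).mulVecLin.prod (P.AEq i).mulVecLin) = ⊤ := by
    rw [LinearMap.range_eq_top] at htop ⊢
    rintro ⟨s, t⟩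
    obtain ⟨z, hz⟩ := htop (Sum.elim s t)
    rw [Matrix.mulVecLin_apply, Matrix.fromRows_mulVec] at hz
    refine ⟨z, Prod.ext ?_ ?_⟩
    · funext r
      exact congrFun hz (Sum.inl r)
    · funext r
      exact congrFun hz (Sum.inr r)
  obtain ⟨R, hR⟩ := LinearMap.exists_rightInverse_of_surjective _ hsurj
  exact ⟨LinearMap.toContinuousLinearMap R, fun s => LinearMap.congr_fun hR s⟩

theorem Regular.isOpen_strictSet (hP : P.Regular) (i : V) : IsOpen (P.strictSet i) := by
  have : P.strictSet i = ⋂ j, {z | P.g i j z < 0} := by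
    ext z; simp [strictSet]
  rw [this]
  exact isOpen_iInter_of_finite fun j =>
    isOpen_lt (hP.g_smooth i j).continuous continuous_const

theorem Regular.convex_strictSet (hP : P.Regular) (i : V) : Convex ℝ (P.strictSet i) := by
  have : P.strictSet i = ⋂ j, {z ∈ univ | P.g i j z < 0} := by
    ext z; simp [strictSet]
  rw [this]
  exact convex_iInter fun j => (hP.g_convex i j).convex_lt 0

theorem Regular.convexOn_F (hP : P.Regular) (hB : P.IsBarrier) {c : ℝ} (hc : 0 ≤ c) (i : V) :
    ConvexOn ℝ (P.strictSet i) (P.F c i) := by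
  have hs := hP.convex_strictSet i
  have h1 : ConvexOn ℝ (P.strictSet i) (P.f i) :=
    (hP.f_convex i).subset (strictSet_subset_localSet i) hs
  have h2 : ConvexOn ℝ (P.strictSet i) (∑ j, P.B i j) := by
    refine Finset.sum_induction _ (ConvexOn ℝ (P.strictSet i)) (fun _ _ => ConvexOn.add)
      (convexOn_const 0 hs) fun j _ => hB.convex i j
  have h3 := h1.add (h2.smul hc)
  have he : P.F c i = P.f i + fun z => c • (∑ j, P.B i j) z := by
    funext z
    simp [F]
  rw [he]
  exact h3

theorem Regular.contDiffOn_F (hP : P.Regular) (hB : P.IsBarrier) (c : ℝ) (i : V) :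
    ContDiffOn ℝ 2 (P.F c i) (P.strictSet i) :=
  ((hP.f_smooth i).mono (strictSet_subset_localSet i)).add
    (contDiffOn_const.mul (ContDiffOn.sum fun j _ => hB.smooth i j))

theorem Regular.differentiableOn_F (hP : P.Regular) (hB : P.IsBarrier) (c : ℝ) (i : V) :
    DifferentiableOn ℝ (P.F c i) (P.strictSet i) :=
  (hP.contDiffOn_F hB c i).differentiableOn (by norm_num)

theorem Regular.hasFDerivAt_F (hP : P.Regular) (hB : P.IsBarrier) (c : ℝ) {i : V}
    {z : Fin (P.d i) → ℝ} (hz : z ∈ P.strictSet i) :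
    HasFDerivAt (P.F c i) (fderiv ℝ (P.F c i) z) z :=
  ((hP.differentiableOn_F hB c i).differentiableAt
    ((hP.isOpen_strictSet i).mem_nhds hz)).hasFDerivAt

theorem Regular.continuousOn_fderiv_F (hP : P.Regular) (hB : P.IsBarrier) (c : ℝ) (i : V) :
    ContinuousOn (fderiv ℝ (P.F c i)) (P.strictSet i) :=
  (hP.contDiffOn_F hB c i).continuousOn_fderiv_of_isOpen (hP.isOpen_strictSet i) (by norm_num)

theorem barrierFeasible_subset_feasible : P.barrierFeasible ⊆ P.feasible :=
  fun _ hx => ⟨fun i => strictSet_subset_localSet i (hx.1 i), hx.2⟩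

theorem Regular.barrierFeasible_nonempty (hP : P.Regular) : P.barrierFeasible.Nonempty := by
  obtain ⟨x, hx, hc⟩ := hP.slater
  exact ⟨x, hx, hc⟩

/-- The set of `i`-th components of feasible points. -/
def shadow (P : Problem V) (i : V) : Set (Fin (P.d i) → ℝ) := (fun x : P.Point => x i) '' P.feasible

theorem Regular.isCompact_shadow (hP : P.Regular) (i : V) : IsCompact (P.shadow i) :=
  hP.compact.image (continuous_apply i)

theorem shadow_subset_localSet (i : V) : P.shadow i ⊆ P.localSet i := by
  rintro _ ⟨x, hx, rfl⟩
  exact hx.1 i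

theorem Regular.exists_le_f (hP : P.Regular) : ∃ m : V → ℝ, ∀ x ∈ P.feasible, ∀ i,
    m i ≤ P.f i (x i) := by
  have h : ∀ i, ∃ m, ∀ z ∈ P.shadow i, m ≤ P.f i z := fun i => by
    obtain ⟨m, hm⟩ := ((hP.isCompact_shadow i).image_of_continuousOn
      ((hP.f_smooth i).continuousOn.mono (shadow_subset_localSet i))).bddBelow
    exact ⟨m, fun z hz => hm (mem_image_of_mem _ hz)⟩
  choose m hm using h
  exact ⟨m, fun x hx i => hm i _ (mem_image_of_mem (fun x : P.Point => x i) hx)⟩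

theorem Regular.exists_le_B (hP : P.Regular) (hB : P.IsBarrier) :
    ∃ m : ∀ i, Fin (P.p i) → ℝ, ∀ x ∈ P.barrierFeasible, ∀ i j, m i j ≤ P.B i j (x i) := by
  obtain ⟨s, hs, -⟩ := hP.slater
  have h : ∀ i j, ∃ m, ∀ z ∈ P.shadow i, z ∈ P.strictSet i → m ≤ P.B i j z := fun i j => by
    -- The strict set is not closed, so compactness does not bound the barrier directly; its tangent
    -- at the Slater point is an affine minorant that is bounded on the shadow.
    have hd : HasFDerivAt (P.B i j) (fderiv ℝ (P.B i j) (s i)) (s i) :=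
      (((hB.smooth i j).differentiableOn (by norm_num)).differentiableAt
        ((hP.isOpen_strictSet i).mem_nhds (hs i))).hasFDerivAt
    have hcont : Continuous fun z => P.B i j (s i) + fderiv ℝ (P.B i j) (s i) (z - s i) := by
      fun_prop
    obtain ⟨m, hm⟩ := ((hP.isCompact_shadow i).image hcont).bddBelow
    exact ⟨m, fun z hz hz' => (hm (mem_image_of_mem _ hz)).trans
      (convexOn_add_fderiv_le (hB.convex i j) (hs i) hz' hd)⟩
  choose m hm using h
  exact ⟨m, fun x hx i j => hm i j _
    (mem_image_of_mem (fun x : P.Point => x i) (barrierFeasible_subset_feasible hx)) (hx.1 i)⟩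

/-- Sublevel sets of the barrier problem stay in compact subsets of the strict local sets. -/
theorem Regular.exists_compact (hP : P.Regular) (hB : P.IsBarrier) {c : ℝ} (hc : 0 < c) (M : ℝ) :
    ∃ K : ∀ i, Set (Fin (P.d i) → ℝ), (∀ i, IsCompact (K i)) ∧ (∀ i, K i ⊆ P.strictSet i) ∧
      ∀ x ∈ P.barrierFeasible, ∑ i, P.F c i (x i) ≤ M → ∀ i, x i ∈ K i := by
  obtain ⟨mf, hmf⟩ := hP.exists_le_f
  obtain ⟨mB, hmB⟩ := hP.exists_le_B hB
  set m : ℝ := ∑ i, (mf i + c * ∑ j, mB i j) with hm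
  -- All other terms are bounded below, so a bound on the total objective bounds each single barrier
  -- value.
  have key : ∀ x ∈ P.barrierFeasible, ∑ i, P.F c i (x i) ≤ M → ∀ i j,
      P.B i j (x i) ≤ (M - m) / c + mB i j := by
    intro x hx hxM i j
    have h1 : ∀ i, c * ∑ j, (P.B i j (x i) - mB i j) ≤
        P.F c i (x i) - (mf i + c * ∑ j, mB i j) := fun i => by
      have := hmf x (barrierFeasible_subset_feasible hx) i
      rw [Finset.sum_sub_distrib, mul_sub, F]
      linarith
    have h0 : ∀ i, 0 ≤ ∑ j, (P.B i j (x i) - mB i j) := fun i =>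
      Finset.sum_nonneg fun j _ => sub_nonneg.2 (hmB x hx i j)
    have h2 : P.F c i (x i) - (mf i + c * ∑ j, mB i j) ≤ M - m := by
      refine (Finset.single_le_sum (f := fun i => P.F c i (x i) - (mf i + c * ∑ j, mB i j))
        (fun i _ => (mul_nonneg hc.le (h0 i)).trans (h1 i)) (Finset.mem_univ i)).trans ?_
      rw [Finset.sum_sub_distrib]
      linarith
    have h3 : P.B i j (x i) - mB i j ≤ ∑ j, (P.B i j (x i) - mB i j) :=
      Finset.single_le_sum (f := fun j => P.B i j (x i) - mB i j)
        (fun j _ => sub_nonneg.2 (hmB x hx i j)) (Finset.mem_univ j)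
    have h4 : ∑ j, (P.B i j (x i) - mB i j) ≤ (M - m) / c := by
      rw [le_div_iff₀ hc, mul_comm]
      exact (h1 i).trans h2
    linarith
  choose δ hδ hδB using fun i j => hB.exists_pos_le_neg i j ((M - m) / c + mB i j)
  refine ⟨fun i => P.shadow i ∩ ⋂ j, {z | P.g i j z ≤ -δ i j}, fun i => ?_, fun i z hz j => ?_,
    fun x hx hxM i => ⟨mem_image_of_mem (fun x : P.Point => x i)
      (barrierFeasible_subset_feasible hx), ?_⟩⟩
  · exact (hP.isCompact_shadow i).inter_right (isClosed_iInter fun j =>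
      isClosed_le (hP.g_smooth i j).continuous continuous_const)
  · have := mem_iInter.1 hz.2 j
    have h' : P.g i j z ≤ -δ i j := this
    linarith [hδ i j]
  · exact mem_iInter.2 fun j => hδB i j _ (hx.1 i) (key x hx hxM i j)

end RegularFacts

/-! ### Finiteness and approximation of the optimal values -/

section Values

/-- The infimum of a real function that is bounded below on a nonempty set is finite. -/
theorem exists_coe_eq_iInf {α : Type*} {S : Set α} {φ : α → ℝ} (hS : S.Nonempty) {m : ℝ}
    (hm : ∀ x ∈ S, m ≤ φ x) :
    ∃ r : ℝ, (⨅ x ∈ S, ((φ x : ℝ) : EReal)) = (r : EReal) ∧ (∀ x ∈ S, r ≤ φ x) ∧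
      ∀ ε > 0, ∃ x ∈ S, φ x < r + ε := by
  have hb : BddBelow (φ '' S) := ⟨m, by rintro _ ⟨x, hx, rfl⟩; exact hm x hx⟩
  have hl : ∀ x ∈ S, sInf (φ '' S) ≤ φ x := fun x hx => csInf_le hb (mem_image_of_mem _ hx)
  have happ : ∀ ε > 0, ∃ x ∈ S, φ x < sInf (φ '' S) + ε := fun ε hε => by
    obtain ⟨_, ⟨x, hx, rfl⟩, h⟩ := Real.lt_sInf_add_pos (hS.image φ) hε
    exact ⟨x, hx, h⟩
  refine ⟨sInf (φ '' S), le_antisymm ?_ ?_, hl, happ⟩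
  · refine EReal.le_of_forall_lt_iff_le.1 fun z hz => ?_
    have hz' := EReal.coe_lt_coe_iff.1 hz
    obtain ⟨x, hx, h⟩ := happ (z - sInf (φ '' S)) (sub_pos.2 hz')
    exact (iInf₂_le x hx).trans (EReal.coe_le_coe_iff.2 (by linarith))
  · exact le_iInf₂ fun x hx => EReal.coe_le_coe_iff.2 (hl x hx)

variable {V : Type*} [Fintype V] {P : Problem V}

theorem Regular.exists_barrierOptVal (hP : P.Regular) (hB : P.IsBarrier) {c : ℝ} (hc : 0 ≤ c) :
    ∃ r : ℝ, P.barrierOptVal c = (r : EReal) ∧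
      (∀ x ∈ P.barrierFeasible, r ≤ ∑ i, P.F c i (x i)) ∧
      ∀ ε > 0, ∃ x ∈ P.barrierFeasible, ∑ i, P.F c i (x i) < r + ε := by
  obtain ⟨mf, hmf⟩ := hP.exists_le_f
  obtain ⟨mB, hmB⟩ := hP.exists_le_B hB
  refine exists_coe_eq_iInf (m := ∑ i, (mf i + c * ∑ j, mB i j)) hP.barrierFeasible_nonempty
    fun x hx => Finset.sum_le_sum fun i _ => ?_
  exact add_le_add (hmf x (barrierFeasible_subset_feasible hx) i)
    (mul_le_mul_of_nonneg_left (Finset.sum_le_sum fun j _ => hmB x hx i j) hc)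

theorem Regular.exists_optVal (hP : P.Regular) :
    ∃ r : ℝ, P.optVal = (r : EReal) ∧ (∀ x ∈ P.feasible, r ≤ ∑ i, P.f i (x i)) ∧
      ∀ ε > 0, ∃ x ∈ P.feasible, ∑ i, P.f i (x i) < r + ε := by
  obtain ⟨mf, hmf⟩ := hP.exists_le_f
  exact exists_coe_eq_iInf (m := ∑ i, mf i)
    (hP.barrierFeasible_nonempty.mono barrierFeasible_subset_feasible)
    fun x hx => Finset.sum_le_sum fun i _ => hmf x hx i

/-- The strictly feasible points are dense enough to approximate the optimal value. -/
theorem Regular.exists_barrierFeasible_lt (hP : P.Regular) {r : ℝ}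
    (hr : ∀ ε > 0, ∃ x ∈ P.feasible, ∑ i, P.f i (x i) < r + ε) {ε : ℝ} (hε : 0 < ε) :
    ∃ x ∈ P.barrierFeasible, ∑ i, P.f i (x i) < r + ε := by
  obtain ⟨s, hs, hsc⟩ := hP.slater
  obtain ⟨x, hx, hxr⟩ := hr ε hε
  -- A short move from `x` towards the Slater point gives strict feasibility, and convexity bounds
  -- the cost by this interpolation.
  have hcont : Tendsto (fun t : ℝ => (1 - t) * ∑ i, P.f i (x i) + t * ∑ i, P.f i (s i)) (𝓝[>] 0)
      (𝓝 (∑ i, P.f i (x i))) := by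
    have : Continuous fun t : ℝ => (1 - t) * ∑ i, P.f i (x i) + t * ∑ i, P.f i (s i) := by
      fun_prop
    exact (this.tendsto' 0 _ (by simp)).mono_left nhdsWithin_le_nhds
  have h01 : Ioo (0 : ℝ) 1 ∈ 𝓝[>] (0 : ℝ) := Ioo_mem_nhdsGT one_pos
  obtain ⟨t, hlt, ht0, ht1⟩ := ((hcont.eventually_lt_const hxr).and h01).exists
  refine ⟨fun i => (1 - t) • x i + t • s i, ⟨fun i j => ?_, ?_⟩, lt_of_le_of_lt ?_ hlt⟩
  · have h1 := (hP.g_convex i j).2 (mem_univ (x i)) (mem_univ (s i)) (sub_nonneg.2 ht1.le) ht0.le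
      (by ring)
    have h2 : P.g i j (x i) ≤ 0 := hx.1 i j
    have h3 := hs i j
    simp only [smul_eq_mul] at h1
    nlinarith
  · rw [coupling_iff] at hsc ⊢
    have hxc := coupling_iff.1 hx.2
    have := add_mem_slackCone _ (smul_mem_slackCone (1 - t) (sub_nonneg.2 ht1.le) _ hxc) _
      (smul_mem_slackCone t ht0.le _ hsc)
    convert this using 1
    simp only [map_add, map_smul, Finset.sum_add_distrib, ← Finset.smul_sum]
    module
  · rw [Finset.mul_sum, Finset.mul_sum, ← Finset.sum_add_distrib]
    exact Finset.sum_le_sum fun i _ => (hP.f_convex i).2 (hx.1 i)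
      (strictSet_subset_localSet i (hs i)) (sub_nonneg.2 ht1.le) ht0.le (by ring)

end Values

theorem mem_closedNbhd {V : Type*} [Fintype V] {G : SimpleGraph V} {i j : V} :
    j ∈ closedNbhd G i ↔ j = i ∨ G.Adj i j := by
  simp [closedNbhd]

theorem self_mem_closedNbhd {V : Type*} [Fintype V] (G : SimpleGraph V) (i : V) :
    i ∈ closedNbhd G i := mem_closedNbhd.2 (Or.inl rfl)

/-! ### Multipliers along a run and descent of the objective -/

section Multipliers

variable {V : Type*} {P : Problem V}

/-- `l` is a multiplier of the subproblem of node `i` with right-hand side `w` at the point `z`. -/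
structure IsMultiplier (P : Problem V) (c : ℝ) (i : V) (l : P.Rhs →L[ℝ] ℝ)
    (z : Fin (P.d i) → ℝ) (w : P.Rhs) : Prop where
  mem : z ∈ P.strictSet i
  slack : w - P.couplingMap i z ∈ P.slackCone
  stationary : fderiv ℝ (P.F c i) z = -(l.comp (P.couplingMap i))
  nonneg : ∀ s ∈ P.slackCone, 0 ≤ l s
  complementary : l (w - P.couplingMap i z) = 0

variable [Fintype V] {c : ℝ}

theorem SubOptimal.exists_isMultiplier (hP : P.Regular) (hB : P.IsBarrier) {i : V} {w : P.Rhs}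
    {z : Fin (P.d i) → ℝ} (h : P.SubOptimal c i w z) : ∃ l, P.IsMultiplier c i l z w := by
  obtain ⟨R, hR⟩ := hP.exists_rightInverse i
  obtain ⟨hz, hs⟩ := mem_subFeasible_iff.1 h.1
  obtain ⟨l, h1, h2, h3⟩ := exists_multiplier hR add_mem_slackCone smul_mem_slackCone
    (hP.isOpen_strictSet i) hz hs (hP.hasFDerivAt_F hB c hz)
    fun z' hz' hs' => h.2 z' (mem_subFeasible_iff.2 ⟨hz', hs'⟩)
  exact ⟨l, hz, hs, h1, h2, h3⟩

/-- The nodes of an optimal block share a multiplier. -/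
theorem BlockOptimal.exists_multiplier (hP : P.Regular) (hB : P.IsBarrier) {G : SimpleGraph V}
    {i : V} {y : V → P.Rhs} {x : P.Point} (h : P.BlockOptimal c G i y x) :
    ∃ l : P.Rhs →L[ℝ] ℝ,
      (∀ j ∈ closedNbhd G i, fderiv ℝ (P.F c j) (x j) = -(l.comp (P.couplingMap j))) ∧
      (∀ s ∈ P.slackCone, 0 ≤ l s) ∧
      l (∑ j ∈ closedNbhd G i, y j - ∑ j ∈ closedNbhd G i, P.couplingMap j (x j)) = 0 := by
  classical
  obtain ⟨R, hR⟩ := hP.exists_rightInverse i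
  obtain ⟨hx, hs⟩ := blockFeasible_iff.1 h.1
  set N := closedNbhd G i with hN
  let pr : ∀ j, P.Point →L[ℝ] (Fin (P.d j) → ℝ) := fun j =>
    ContinuousLinearMap.proj (R := ℝ) (φ := fun j => Fin (P.d j) → ℝ) j
  let A : P.Point →L[ℝ] P.Rhs := ∑ j ∈ N, (P.couplingMap j).comp (pr j)
  have hA : ∀ x' : P.Point, A x' = ∑ j ∈ N, P.couplingMap j (x' j) := fun x' => by
    simp [A, pr]
  let sg : ∀ j, (Fin (P.d j) → ℝ) →L[ℝ] P.Point := fun j =>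
    ContinuousLinearMap.single ℝ (fun j => Fin (P.d j) → ℝ) j
  have hsg : ∀ j ∈ N, ∀ z, A (sg j z) = P.couplingMap j z := fun j hj z => by
    rw [hA, Finset.sum_eq_single_of_mem j hj]
    · simp [sg]
    · intro k _ hk
      simp [sg, Pi.single_eq_of_ne hk]
  -- Varying the center node alone already realizes every value of the block coupling.
  have hAR : ∀ s, A (((sg i).comp R) s) = s := fun s => by
    rw [ContinuousLinearMap.comp_apply, hsg i (self_mem_closedNbhd G i), hR]
  let S : Set P.Point := {x' | ∀ j ∈ N, x' j ∈ P.strictSet j}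
  have hS : IsOpen S := by
    have : S = ⋂ j ∈ N, (fun x' : P.Point => x' j) ⁻¹' P.strictSet j := by
      ext x'; simp [S]
    rw [this]
    exact isOpen_biInter_finset fun j _ =>
      (hP.isOpen_strictSet j).preimage (continuous_apply j)
  have hd : HasFDerivAt (fun x' : P.Point => ∑ j ∈ N, P.F c j (x' j))
      (∑ j ∈ N, (fderiv ℝ (P.F c j) (x j)).comp (pr j)) x :=
    HasFDerivAt.fun_sum fun j hj => by
      have h1 : HasFDerivAt (P.F c j) (fderiv ℝ (P.F c j) (x j)) (pr j x) :=
        hP.hasFDerivAt_F hB c (hx j hj)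
      exact h1.comp x (pr j).hasFDerivAt
  obtain ⟨l, h1, h2, h3⟩ := DRRA.exists_multiplier (w := ∑ j ∈ N, y j) hAR add_mem_slackCone
    smul_mem_slackCone hS hx (by rw [hA]; exact hs) hd fun x' hx' hs' =>
      h.2 x' (blockFeasible_iff.2 ⟨hx', by rw [← hN, ← hA]; exact hs'⟩)
  refine ⟨l, fun j hj => ?_, h2, by rw [← hA]; exact h3⟩
  ext z
  have := congrArg (fun T : P.Point →L[ℝ] ℝ => T (sg j z)) h1
  simp only [neg_apply, ContinuousLinearMap.comp_apply, hsg j hj] at this ⊢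
  rw [← this, sum_apply, Finset.sum_eq_single_of_mem j hj]
  · simp [sg, pr]
  · intro k _ hk
    simp [sg, pr, Pi.single_eq_of_ne hk]

namespace IsRun

variable {G : SimpleGraph V} {U : ℕ → Finset V} {x : ℕ → P.Point} {y : ℕ → V → P.Rhs}

/-- Sums over the nodes of quantities vanishing at idle nodes split into sums over blocks. -/
theorem sum_eq_sum_blocks (h : P.IsRun c G U x y) {M : Type*} [AddCommMonoid M] (k : ℕ)
    {φ : V → M} (hφ : ∀ j, (∀ i ∈ U k, j ∉ closedNbhd G i) → φ j = 0) :
    ∑ j, φ j = ∑ i ∈ U k, ∑ j ∈ closedNbhd G i, φ j := by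
  classical
  rw [← Finset.sum_biUnion fun i hi j hj hij => h.nonconflict k i hi j hj hij]
  refine (Finset.sum_subset (Finset.subset_univ _) fun j _ hj => hφ j ?_).symm
  simpa using hj

/-- The slack of each node after an update is the averaged slack of its block. -/
theorem slack_eq (h : P.IsRun c G U x y) {k : ℕ} {i j : V} (hi : i ∈ U k)
    (hj : j ∈ closedNbhd G i) :
    y (k + 1) j - P.couplingMap j (x (k + 1) j) = (1 / ((closedNbhd G i).card : ℝ)) •
      (∑ l ∈ closedNbhd G i, y k l -
        ∑ l ∈ closedNbhd G i, P.couplingMap l (x (k + 1) l)) := by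
  have hs := (blockFeasible_iff.1 (h.update_x k i hi).1).2
  refine Prod.ext ?_ ?_
  · rw [Prod.fst_sub, h.update_y_in k i hi j hj, couplingMap_apply]
    simp [Prod.fst_sum, couplingMap_apply]
  · rw [Prod.snd_sub, h.update_y_eq k i hi j hj, couplingMap_apply, Prod.smul_snd, hs.2]
    simp

/-- The equal shares of the block slack add up to that slack, so a block only redistributes its
resources. -/
theorem sum_block (h : P.IsRun c G U x y) {k : ℕ} {i : V} (hi : i ∈ U k) :
    ∑ j ∈ closedNbhd G i, (y (k + 1) j - y k j) = 0 := by
  have h0 : ((closedNbhd G i).card : ℝ) ≠ 0 :=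
    Nat.cast_ne_zero.2 (Finset.card_ne_zero.2 ⟨i, self_mem_closedNbhd G i⟩)
  have h1 : ∑ j ∈ closedNbhd G i, (y (k + 1) j - P.couplingMap j (x (k + 1) j)) =
      ∑ l ∈ closedNbhd G i, y k l - ∑ l ∈ closedNbhd G i, P.couplingMap l (x (k + 1) l) := by
    rw [Finset.sum_congr rfl fun j hj => h.slack_eq hi hj, Finset.sum_const,
      ← Nat.cast_smul_eq_nsmul ℝ, smul_smul, mul_one_div_cancel h0, one_smul]
  rw [Finset.sum_sub_distrib] at h1 ⊢
  rw [sub_eq_zero]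
  exact sub_left_injective h1

theorem sum_y (h : P.IsRun c G U x y) (k : ℕ) : ∑ i, y k i = (P.bIn, P.bEq) := by
  induction k with
  | zero => exact h.init_y.1
  | succ k ih =>
    have h1 := h.sum_eq_sum_blocks k (φ := fun j => y (k + 1) j - y k j) fun j hj => by
      rw [(h.idle k j hj).2, sub_self]
    rw [Finset.sum_eq_zero fun i hi => h.sum_block hi, Finset.sum_sub_distrib, sub_eq_zero] at h1
    rw [h1, ih]

variable (hP : P.Regular) (hB : P.IsBarrier)
include hP hB

/-- After an update all nodes of a block share a multiplier. -/
theorem exists_block_isMultiplier (h : P.IsRun c G U x y) {k : ℕ} {i : V} (hi : i ∈ U k) :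
    ∃ l, ∀ j ∈ closedNbhd G i, P.IsMultiplier c j l (x (k + 1) j) (y (k + 1) j) := by
  obtain ⟨l, h1, h2, h3⟩ := (h.update_x k i hi).exists_multiplier hP hB
  obtain ⟨hx, hs⟩ := blockFeasible_iff.1 (h.update_x k i hi).1
  refine ⟨l, fun j hj => ⟨hx j hj, ?_, h1 j hj, h2, ?_⟩⟩
  · rw [h.slack_eq hi hj]
    exact smul_mem_slackCone _ (by positivity) _ hs
  · rw [h.slack_eq hi hj, map_smul, h3, smul_zero]

/-- Idle nodes keep their point and allocation, hence their multiplier; updated nodes inherit that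
of their block. -/
theorem exists_isMultiplier (h : P.IsRun c G U x y) (k : ℕ) (j : V) :
    ∃ l, P.IsMultiplier c j l (x k j) (y k j) := by
  induction k with
  | zero => exact (h.init_x j).exists_isMultiplier hP hB
  | succ k ih =>
    by_cases hj : ∀ i ∈ U k, j ∉ closedNbhd G i
    · rw [(h.idle k j hj).1, (h.idle k j hj).2]
      exact ih
    · push Not at hj
      obtain ⟨i, hi, hj⟩ := hj
      obtain ⟨l, hl⟩ := h.exists_block_isMultiplier hP hB hi
      exact ⟨l, hl j hj⟩

theorem mem_barrierFeasible (h : P.IsRun c G U x y) (k : ℕ) : x k ∈ P.barrierFeasible := by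
  choose l hl using h.exists_isMultiplier hP hB k
  refine ⟨fun i => (hl i).mem, ?_⟩
  rw [coupling_iff, ← h.sum_y k, ← Finset.sum_sub_distrib]
  exact sum_mem_slackCone fun i _ => (hl i).slack

/-- The Bregman distances of the nodes of an updated block are controlled by the decrease of the
block objective. -/
theorem sum_bregman_le (h : P.IsRun c G U x y) {k : ℕ} {i : V} (hi : i ∈ U k) :
    ∑ j ∈ closedNbhd G i, (P.F c j (x k j) - P.F c j (x (k + 1) j) -
        fderiv ℝ (P.F c j) (x (k + 1) j) (x k j - x (k + 1) j)) ≤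
      ∑ j ∈ closedNbhd G i, (P.F c j (x k j) - P.F c j (x (k + 1) j)) := by
  obtain ⟨l, hl⟩ := h.exists_block_isMultiplier hP hB hi
  choose l' hl' using h.exists_isMultiplier hP hB k
  -- Complementarity at the new point turns the gradient term into the price of the old slack plus
  -- the price of the change in allocation. The latter sums to zero over the block, the former is
  -- nonnegative.
  have h1 : ∀ j ∈ closedNbhd G i, fderiv ℝ (P.F c j) (x (k + 1) j) (x k j - x (k + 1) j) =
      l (y k j - P.couplingMap j (x k j)) + l (y (k + 1) j - y k j) := fun j hj => by
    have h3 := (hl j hj).complementary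
    rw [(hl j hj).stationary]
    simp only [neg_apply, ContinuousLinearMap.comp_apply, map_sub] at h3 ⊢
    linarith
  have h2 : 0 ≤ ∑ j ∈ closedNbhd G i,
      fderiv ℝ (P.F c j) (x (k + 1) j) (x k j - x (k + 1) j) := by
    rw [Finset.sum_congr rfl h1, Finset.sum_add_distrib, ← map_sum l (fun j => y (k + 1) j - y k j),
      h.sum_block hi, map_zero, add_zero]
    exact Finset.sum_nonneg fun j hj =>
      (hl i (self_mem_closedNbhd G i)).nonneg _ (hl' j).slack
  rw [Finset.sum_sub_distrib]
  linarith

variable (hc : 0 < c)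
include hc

theorem bregman_nonneg (h : P.IsRun c G U x y) (k : ℕ) (j : V) :
    0 ≤ P.F c j (x k j) - P.F c j (x (k + 1) j) -
        fderiv ℝ (P.F c j) (x (k + 1) j) (x k j - x (k + 1) j) := by
  have hm := (h.mem_barrierFeasible hP hB (k + 1)).1 j
  have := convexOn_add_fderiv_le (hP.convexOn_F hB hc.le j) hm
    ((h.mem_barrierFeasible hP hB k).1 j) (hP.hasFDerivAt_F hB c hm)
  linarith

/-- The Bregman distance of each node is controlled by the decrease of the objective. -/
theorem bregman_le (h : P.IsRun c G U x y) (k : ℕ) (j : V) :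
    P.F c j (x k j) - P.F c j (x (k + 1) j) -
        fderiv ℝ (P.F c j) (x (k + 1) j) (x k j - x (k + 1) j) ≤
      ∑ i, P.F c i (x k i) - ∑ i, P.F c i (x (k + 1) i) := by
  refine (Finset.single_le_sum (f := fun j => P.F c j (x k j) - P.F c j (x (k + 1) j) -
    fderiv ℝ (P.F c j) (x (k + 1) j) (x k j - x (k + 1) j))
    (fun j _ => h.bregman_nonneg hP hB hc k j) (Finset.mem_univ j)).trans ?_
  rw [← Finset.sum_sub_distrib, h.sum_eq_sum_blocks k fun j hj => by
      rw [(h.idle k j hj).1]; simp,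
    h.sum_eq_sum_blocks k fun j hj => by rw [(h.idle k j hj).1, sub_self]]
  exact Finset.sum_le_sum fun i hi => h.sum_bregman_le hP hB hi

theorem antitone_objective (h : P.IsRun c G U x y) :
    Antitone fun k => ∑ i, P.F c i (x k i) := by
  refine antitone_nat_of_succ_le fun k => ?_
  obtain hV | ⟨⟨j⟩⟩ := isEmpty_or_nonempty V
  · simp
  · have h1 := h.bregman_nonneg hP hB hc k j
    have h2 := h.bregman_le hP hB hc k j
    linarith

end IsRun

end Multipliers

/-! ### Consensus of multipliers and convergence of the objective -/

section Convergence

variable {V : Type*} {P : Problem V} {c : ℝ}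

/-- Multipliers are unique and depend continuously on the gradient, so gradient estimates become
multiplier estimates. -/
theorem IsMultiplier.eq_neg_comp {i : V} {l : P.Rhs →L[ℝ] ℝ} {z : Fin (P.d i) → ℝ} {w : P.Rhs}
    (h : P.IsMultiplier c i l z w) {R : P.Rhs →L[ℝ] (Fin (P.d i) → ℝ)}
    (hR : ∀ s, P.couplingMap i (R s) = s) : l = -((fderiv ℝ (P.F c i) z).comp R) := by
  rw [h.stationary]
  ext s <;> simp [hR]

variable [Fintype V]

namespace IsRun

variable {G : SimpleGraph V} {U : ℕ → Finset V} {x : ℕ → P.Point} {y : ℕ → V → P.Rhs}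

variable (hP : P.Regular) (hB : P.IsBarrier)
include hP hB

/-- The allocations stay bounded. -/
theorem exists_norm_le (h : P.IsRun c G U x y) : ∃ C, ∀ k j, ‖y k j‖ ≤ C := by
  have hcont : Continuous fun x : P.Point =>
      ‖((P.bIn, P.bEq) : P.Rhs) - ∑ i, P.couplingMap i (x i)‖ + ∑ i, ‖P.couplingMap i (x i)‖ := by
    fun_prop
  obtain ⟨C, hC⟩ := (hP.compact.image hcont).bddAbove
  refine ⟨C, fun k j => ?_⟩
  refine le_trans ?_ (hC (mem_image_of_mem _
    (barrierFeasible_subset_feasible (h.mem_barrierFeasible hP hB k))))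
  choose l hl using h.exists_isMultiplier hP hB k
  -- All node slacks lie in the cone, so each is squeezed between zero and the total slack, a
  -- continuous function of a point of the compact feasible set.
  have h1 : ‖y k j - P.couplingMap j (x k j)‖ ≤
      ‖((P.bIn, P.bEq) : P.Rhs) - ∑ i, P.couplingMap i (x k i)‖ := by
    classical
    refine norm_le_of_mem_slackCone (hl j).slack ?_
    rw [← h.sum_y k, ← Finset.sum_sub_distrib, ← Finset.sum_erase_eq_sub (Finset.mem_univ j)]
    exact sum_mem_slackCone fun i _ => (hl i).slack
  have h2 : ‖P.couplingMap j (x k j)‖ ≤ ∑ i, ‖P.couplingMap i (x k i)‖ :=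
    Finset.single_le_sum (f := fun i => ‖P.couplingMap i (x k i)‖)
      (fun i _ => norm_nonneg _) (Finset.mem_univ j)
  calc ‖y k j‖ = ‖(y k j - P.couplingMap j (x k j)) + P.couplingMap j (x k j)‖ := by
        rw [sub_add_cancel]
    _ ≤ _ := (norm_add_le _ _).trans (add_le_add h1 h2)

variable (hc : 0 < c)
include hc

/-- Weak duality with node-dependent multipliers. -/
theorem objective_le_add_disagreement (h : P.IsRun c G U x y) {z : P.Point}
    (hz : z ∈ P.barrierFeasible) {k : ℕ} {l : V → P.Rhs →L[ℝ] ℝ}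
    (hl : ∀ j, P.IsMultiplier c j (l j) (x k j) (y k j)) (o : V) :
    ∑ j, P.F c j (x k j) ≤ ∑ j, P.F c j (z j) +
      ∑ j, (l j - l o) (P.couplingMap j (z j) - y k j) := by
  have h1 : ∀ j, P.F c j (x k j) ≤
      P.F c j (z j) + l j (P.couplingMap j (z j) - y k j) := fun j => by
    have h2 := convexOn_add_fderiv_le (hP.convexOn_F hB hc.le j) (hl j).mem (hz.1 j)
      (hP.hasFDerivAt_F hB c (hl j).mem)
    have h3 := (hl j).complementary
    rw [(hl j).stationary] at h2
    simp only [neg_apply, ContinuousLinearMap.comp_apply, map_sub] at h2 h3 ⊢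
    linarith
  have h4 : 0 ≤ l o (((P.bIn, P.bEq) : P.Rhs) - ∑ j, P.couplingMap j (z j)) :=
    (hl o).nonneg _ (coupling_iff.1 hz.2)
  -- Since the allocations sum to `b`, replacing each `l j` by the reference `l o` leaves exactly
  -- the price of the total slack of `z`.
  have h5 : ∑ j, (l j - l o) (P.couplingMap j (z j) - y k j) =
      ∑ j, l j (P.couplingMap j (z j) - y k j) +
        l o (((P.bIn, P.bEq) : P.Rhs) - ∑ j, P.couplingMap j (z j)) := by
    rw [← h.sum_y k, ← Finset.sum_sub_distrib, map_sum, ← Finset.sum_add_distrib]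
    refine Finset.sum_congr rfl fun j _ => ?_
    simp only [sub_apply, map_sub]
    ring
  have h6 := Finset.sum_le_sum fun j (_ : j ∈ Finset.univ) => h1 j
  rw [Finset.sum_add_distrib] at h6
  linarith

/-- Along a run that infinitely often selects every node within windows of a fixed length, the
objective tends to the optimal value. -/
theorem tendsto_objective (hG : G.Connected) (h : P.IsRun c G U x y) {n : ℕ} {w : ℕ → V}
    (hw : ∀ v, ∃ t < n, w t = v) (hU : ∃ᶠ k in atTop, ∀ t < n, w t ∈ U (k + t)) {r : ℝ}
    (hr : ∀ x ∈ P.barrierFeasible, r ≤ ∑ i, P.F c i (x i))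
    (hr' : ∀ ε > 0, ∃ x ∈ P.barrierFeasible, ∑ i, P.F c i (x i) < r + ε) :
    Tendsto (fun k => ∑ i, P.F c i (x k i)) atTop (𝓝 r) := by
  set Φ : ℕ → ℝ := fun k => ∑ i, P.F c i (x k i) with hΦ
  have hanti : Antitone Φ := h.antitone_objective hP hB hc
  have hbdd : BddBelow (range Φ) :=
    ⟨r, by rintro _ ⟨k, rfl⟩; exact hr _ (h.mem_barrierFeasible hP hB k)⟩
  have hlim : Tendsto Φ atTop (𝓝 (⨅ k, Φ k)) := tendsto_atTop_ciInf hanti hbdd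
  set L := ⨅ k, Φ k
  obtain ⟨K, hK, hKS, hKx⟩ := hP.exists_compact hB hc (Φ 0)
  have hxK : ∀ k j, x k j ∈ K j := fun k =>
    hKx _ (h.mem_barrierFeasible hP hB k) (hanti (Nat.zero_le k))
  choose R hR using hP.exists_rightInverse
  set Λ : ℕ → V → P.Rhs →L[ℝ] ℝ := fun k j => -((fderiv ℝ (P.F c j) (x k j)).comp (R j)) with hΛ
  have hmult : ∀ k j, P.IsMultiplier c j (Λ k j) (x k j) (y k j) := fun k j => by
    obtain ⟨l, hl⟩ := h.exists_isMultiplier hP hB k j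
    rwa [hl.eq_neg_comp (hR j)] at hl
  have hdec : Tendsto (fun k => Φ k - Φ (k + 1)) atTop (𝓝 0) := by
    simpa using hlim.sub (hlim.comp (tendsto_add_atTop_nat 1))
  have hstep : ∀ j, Tendsto (fun k => Λ (k + 1) j - Λ k j) atTop (𝓝 0) := fun j => by
    have h1 := tendsto_fderiv_sub_of_bregman (hP.convexOn_F hB hc.le j) (hP.isOpen_strictSet j)
      (hP.differentiableOn_F hB c j) (hP.continuousOn_fderiv_F hB c j) (hK j) (hKS j)
      (u := fun k => x k j) (v := fun k => x (k + 1) j) (fun k => hxK k j) (fun k => hxK (k + 1) j)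
      (squeeze_zero (fun k => h.bregman_nonneg hP hB hc k j)
        (fun k => h.bregman_le hP hB hc k j) hdec)
    have hcomp : Continuous fun T : (Fin (P.d j) → ℝ) →L[ℝ] ℝ => T.comp (R j) :=
      continuous_id.clm_comp continuous_const
    have h2 := (hcomp.tendsto 0).comp h1
    rw [ContinuousLinearMap.zero_comp] at h2
    refine h2.congr fun k => ?_
    simp only [hΛ, Function.comp_apply, ContinuousLinearMap.sub_comp]
    rw [neg_sub_neg]
  obtain ⟨φ, hφ, hφU⟩ := extraction_of_frequently_atTop hU
  have hshift : ∀ j t, Tendsto (fun m => Λ (φ m + t) j - Λ (φ m) j) atTop (𝓝 0) := by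
    intro j t
    induction t with
    | zero => simp
    | succ t ih =>
      have h1 : Tendsto (fun m => φ m + t) atTop atTop :=
        tendsto_atTop_mono (fun m => Nat.le_add_right _ t) hφ.tendsto_atTop
      have h2 := ((hstep j).comp h1).add ih
      rw [add_zero] at h2
      refine h2.congr fun m => ?_
      simp only [Function.comp_apply, add_assoc, sub_add_sub_cancel]
  have hadj : ∀ i j, G.Adj i j → Tendsto (fun m => Λ (φ m) i - Λ (φ m) j) atTop (𝓝 0) := by
    intro i j hij
    obtain ⟨t, ht, rfl⟩ := hw i
    -- Node `w t` is updated at time `φ m + t`, so agreement with its neighbors holds at time `φ m +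
    -- t + 1` and is carried back to `φ m`.
    have h1 := (hshift j (t + 1)).sub (hshift (w t) (t + 1))
    rw [sub_zero] at h1
    refine h1.congr fun m => ?_
    obtain ⟨l, hl⟩ := h.exists_block_isMultiplier hP hB (hφU m t ht)
    have e1 := (hl (w t) (self_mem_closedNbhd G (w t))).eq_neg_comp (hR (w t))
    have e2 := (hl j (mem_closedNbhd.2 (Or.inr hij))).eq_neg_comp (hR j)
    have e3 : Λ (φ m + (t + 1)) (w t) = Λ (φ m + (t + 1)) j := e1.symm.trans e2
    rw [e3]
    abel
  have hcons : ∀ i j, Tendsto (fun m => Λ (φ m) i - Λ (φ m) j) atTop (𝓝 0) := by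
    intro i j
    obtain ⟨p⟩ := hG.preconnected i j
    induction p with
    | nil => simp
    | cons hab _ ih => simpa using (hadj _ _ hab).add ih
  obtain ⟨C, hC⟩ := h.exists_norm_le hP hB
  obtain ⟨o⟩ := hG.nonempty
  have hle : ∀ z ∈ P.barrierFeasible, L ≤ ∑ j, P.F c j (z j) := by
    intro z hz
    -- Allocations are bounded, so vanishing disagreement of multipliers removes the duality error.
    have h1 : ∀ j, Tendsto (fun m => (Λ (φ m) j - Λ (φ m) o)
        (P.couplingMap j (z j) - y (φ m) j)) atTop (𝓝 0) := fun j => by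
      have h2 : Tendsto (fun m => ‖Λ (φ m) j - Λ (φ m) o‖ * (‖P.couplingMap j (z j)‖ + C)) atTop
          (𝓝 0) := by
        simpa using (hcons j o).norm.mul_const (‖P.couplingMap j (z j)‖ + C)
      refine squeeze_zero_norm (fun m => ?_) h2
      refine (ContinuousLinearMap.le_opNorm _ _).trans (mul_le_mul_of_nonneg_left ?_
        (norm_nonneg _))
      exact (norm_sub_le _ _).trans (add_le_add le_rfl (hC _ _))
    have h3 := (tendsto_const_nhds (x := ∑ j, P.F c j (z j))).add
      (tendsto_finsetSum Finset.univ fun j _ => h1 j)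
    rw [Finset.sum_const_zero, add_zero] at h3
    exact le_of_tendsto_of_tendsto' (hlim.comp hφ.tendsto_atTop) h3 fun m =>
      h.objective_le_add_disagreement hP hB hc hz (hmult (φ m)) o
  have hLr : L = r := by
    refine le_antisymm (le_of_forall_pos_le_add fun ε hε => ?_)
      (le_ciInf fun k => hr _ (h.mem_barrierFeasible hP hB k))
    obtain ⟨z, hz, hzr⟩ := hr' ε hε
    exact (hle z hz).trans hzr.le
  rw [← hLr]
  exact hlim

end IsRun

/-- Almost surely the objective tends to the optimal value of the barrier problem. -/
theorem Regular.ae_tendsto_objective (hP : P.Regular) (hB : P.IsBarrier) (hc : 0 < c)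
    {G : SimpleGraph V} (hG : G.Connected) {r : ℝ}
    (hr : ∀ x ∈ P.barrierFeasible, r ≤ ∑ i, P.F c i (x i))
    (hr' : ∀ ε > 0, ∃ x ∈ P.barrierFeasible, ∑ i, P.F c i (x i) < r + ε)
    {Ω : Type*} [MeasurableSpace Ω] {μ : Measure Ω} [IsProbabilityMeasure μ]
    {U : ℕ → Ω → Finset V} {x : ℕ → Ω → P.Point} {y : ℕ → Ω → V → P.Rhs}
    (hrun : ∀ ω, P.IsRun c G (fun k => U k ω) (fun k => x k ω) (fun k => y k ω))
    (hsel : SelectionAssumption μ U) :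
    ∀ᵐ ω ∂μ, Tendsto (fun k => ∑ i, P.F c i (x k ω i)) atTop (𝓝 r) := by
  obtain ⟨o⟩ := hG.nonempty
  set e := Fintype.equivFin V
  -- The word lists every node once; the default `o` lies beyond the window and plays no role.
  let w : ℕ → V := fun t => if ht : t < Fintype.card V then e.symm ⟨t, ht⟩ else o
  have hw : ∀ v, ∃ t < Fintype.card V, w t = v := fun v => ⟨e v, (e v).2, by simp [w]⟩
  filter_upwards [ae_frequently_window hsel w (Fintype.card V)] with ω hω
  exact (hrun ω).tendsto_objective hP hB hc hG hw hω hr hr'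

/-- For a small barrier parameter, points that are nearly optimal for the barrier problem are
nearly optimal for the original one. -/
theorem Regular.exists_barrier_parameter (hP : P.Regular) (hB : P.IsBarrier) {r : ℝ}
    (hr : ∀ ε > 0, ∃ x ∈ P.feasible, ∑ i, P.f i (x i) < r + ε) {ε : ℝ} (hε : 0 < ε) :
    ∃ cbar > 0, ∀ c ∈ Ioc 0 cbar, ∃ z ∈ P.barrierFeasible, ∃ δ > 0, ∀ x ∈ P.barrierFeasible,
      ∑ i, P.F c i (x i) < ∑ i, P.F c i (z i) + δ → ∑ i, P.f i (x i) ≤ r + ε := by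
  obtain ⟨z, hz, hzr⟩ := hP.exists_barrierFeasible_lt hr (half_pos hε)
  obtain ⟨mB, hmB⟩ := hP.exists_le_B hB
  have hsplit : ∀ (c : ℝ) (x : P.Point), ∑ i, P.F c i (x i) =
      ∑ i, P.f i (x i) + c * ∑ i, ∑ j, P.B i j (x i) := fun c x => by
    simp only [F, Finset.sum_add_distrib, Finset.mul_sum]
  set D := ∑ i, ∑ j, P.B i j (z i) - ∑ i, ∑ j, mB i j with hD
  have hD0 : 0 ≤ D := sub_nonneg.2
    (Finset.sum_le_sum fun i _ => Finset.sum_le_sum fun j _ => hmB z hz i j)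
  -- The budget is `ε / 2` for the choice of `z`, `ε / 4` for the barrier gap `c * D`, and `ε / 4`
  -- for `δ`; the `+ 1` keeps the denominator positive.
  refine ⟨ε / (4 * (D + 1)), by positivity, fun c hc => ⟨z, hz, ε / 4, by positivity,
    fun x hx hlt => ?_⟩⟩
  have h1 : c * D ≤ ε / 4 := by
    have h2 := mul_le_mul_of_nonneg_right hc.2 (by linarith : 0 ≤ D + 1)
    have h3 : ε / (4 * (D + 1)) * (D + 1) = ε / 4 := by
      field_simp
    nlinarith [hc.1]
  have h4 : c * ∑ i, ∑ j, mB i j ≤ c * ∑ i, ∑ j, P.B i j (x i) :=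
    mul_le_mul_of_nonneg_left
      (Finset.sum_le_sum fun i _ => Finset.sum_le_sum fun j _ => hmB x hx i j) hc.1.le
  rw [hsplit, hsplit] at hlt
  rw [hD, mul_sub] at h1
  linarith

end Convergence

end Problem

end DRRA

end

theorem theorem1 {V : Type*} [Fintype V] (G : SimpleGraph V) (hG : G.Connected)
    (P : DRRA.Problem V) (hP : P.Regular) (hB : P.IsBarrier) :
    -- feasibility of all iterates, and convergence to the optimal value of the barrier problem
    (∀ c : ℝ, 0 < c → ∃ Fstar : ℝ, P.barrierOptVal c = (Fstar : EReal) ∧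
      ∀ {Ω : Type*} [MeasurableSpace Ω] (μ : Measure Ω) [IsProbabilityMeasure μ]
        (U : ℕ → Ω → Finset V) (x : ℕ → Ω → P.Point) (y : ℕ → Ω → V → P.Rhs),
        (∀ ω, P.IsRun c G (fun k => U k ω) (fun k => x k ω) (fun k => y k ω)) →
        DRRA.SelectionAssumption μ U →
        (∀ ω k, x k ω ∈ P.barrierFeasible ∧ x k ω ∈ P.feasible) ∧
        ∀ᵐ ω ∂μ, Tendsto (fun k => ∑ i, P.F c i (x k ω i)) atTop (𝓝 Fstar)) ∧
    -- near-optimality for the original problem when the barrier parameter is small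
    (∃ fstar : ℝ, P.optVal = (fstar : EReal) ∧
      ∀ ε : ℝ, 0 < ε → ∃ cbar : ℝ, 0 < cbar ∧ ∀ c ∈ Set.Ioc 0 cbar,
        ∀ {Ω : Type*} [MeasurableSpace Ω] (μ : Measure Ω) [IsProbabilityMeasure μ]
          (U : ℕ → Ω → Finset V) (x : ℕ → Ω → P.Point) (y : ℕ → Ω → V → P.Rhs),
          (∀ ω, P.IsRun c G (fun k => U k ω) (fun k => x k ω) (fun k => y k ω)) →
          DRRA.SelectionAssumption μ U →
          ∀ᵐ ω ∂μ, limsup (fun k => ((∑ i, P.f i (x k ω i) : ℝ) : EReal)) atTop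
            ≤ ((fstar + ε : ℝ) : EReal)) := by
  refine ⟨fun c hc => ?_, ?_⟩
  · obtain ⟨r, hr0, hr, hr'⟩ := hP.exists_barrierOptVal hB hc.le
    refine ⟨r, hr0, fun μ _ U x y hrun hsel => ⟨fun ω k => ?_, ?_⟩⟩
    · have h := (hrun ω).mem_barrierFeasible hP hB k
      exact ⟨h, DRRA.Problem.barrierFeasible_subset_feasible h⟩
    · exact hP.ae_tendsto_objective hB hc hG hr hr' hrun hsel
  · obtain ⟨r, hr0, -, hr⟩ := hP.exists_optVal
    refine ⟨r, hr0, fun ε hε => ?_⟩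
    obtain ⟨cbar, hcbar, hsmall⟩ := hP.exists_barrier_parameter hB hr hε
    refine ⟨cbar, hcbar, fun c hc Ω _ μ _ U x y hrun hsel => ?_⟩
    obtain ⟨z, hz, δ, hδ, hzδ⟩ := hsmall c hc
    obtain ⟨F, -, hF, hF'⟩ := hP.exists_barrierOptVal hB hc.1.le
    filter_upwards [hP.ae_tendsto_objective hB hc.1 hG hF hF' hrun hsel] with ω hω
    -- The barrier value never exceeds the cost of `z`, so the convergent objective eventually
    -- enters the range where `hzδ` applies.
    have hlt : F < ∑ i, P.F c i (z i) + δ := by linarith [hF z hz]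
    refine limsup_le_of_le (by isBoundedDefault) ?_
    filter_upwards [hω.eventually_lt_const hlt] with k hk
    exact EReal.coe_le_coe_iff.2 (hzδ _ ((hrun ω).mem_barrierFeasible hP hB k) hk)
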